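/- All rings are commutative with $1$. A quasi-identity is a universally quantified implication $(s_1=t_1)\wedge\dots\wedge(s_n=t_n)\to(s_0=t_0)$ between terms $s_i,t_i$ in the language $(+,\cdot,-,0,1)$ of rings, $n\ge 0$; for $n=0$ it is called an identity. A variety (resp. quasivariety) is a class axiomatized by identities (resp. quasi-identities). Let $\mathcal Q$ be the class of all commutative rings $R$ with $1$ such that each principal ideal of $R$ has a unique generator, and let $\mathcal D$ be the class of domains in $\mathcal Q$. (1) $\mathcal Q$ is a quasivariety. It is exactly the class of rings axiomatized by the quasi-identity $(xyz=z)\to(yz=z)$ along with the identities defining the variety of all commutative rings. Every ring in $\mathcal Q$ has trivial unit group, is reduced, and is an $\mathbb F_2$-algebra. (2) $\mathcal D$ is exactly the class of domains with trivial unit group. (3) $\mathcal Q=\mathsf{SP}(\mathcal D)$, that is, $\mathcal Q$ consists of the rings isomorphic to subrings of (possibly empty) products of members of $\mathcal D$. (4) $\mathcal Q$ is a relatively ideal distributive quasivariety: for each $R\in\mathcal Q$, the set of $\mathcal Q$-ideals of $R$ (ideals $I$ with $R/I\in\mathcal Q$) is closed under arbitrary intersections, and for all $\mathcal Q$-ideals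 $I,J,K$ of $R$ one has $I\cap(J\vee K)=(I\cap J)\vee(I\cap K)$, where $A\vee B$ denotes the least $\mathcal Q$-ideal containing $A\cup B$. (5) The class of locally finite members of $\mathcal Q$ (those in which every finitely generated subring is finite) is exactly the class of Boolean rings (rings satisfying $x^2=x$). This class is the largest variety contained in $\mathcal Q$. -/

import Mathlib

universe u

namespace RingClasses

open FirstOrder FirstOrder.Language

/-- Terms in the language of rings `(+, *, -, 0, 1)`, with variables indexed by `ℕ`. -/
abbrev RingTerm : Type := Language.ring.Term ℕ

/-- A quasi-identity `(s₁ = t₁) ∧ ⋯ ∧ (sₙ = tₙ) → (s₀ = t₀)`, universally quantified, `n ≥ 0`;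
an equation is a pair of terms. -/
structure QuasiIdentity where
  premises : List (RingTerm × RingTerm)
  conclusion : RingTerm × RingTerm

/-- An identity is a quasi-identity without premises. -/
def QuasiIdentity.IsIdentity (φ : QuasiIdentity) : Prop := φ.premises = []

/-- The identity `s = t`. -/
def QuasiIdentity.ofEq (s t : RingTerm) : QuasiIdentity := ⟨[], (s, t)⟩

/-- Truth of a quasi-identity in an arbitrary algebra `M` of the signature of rings. -/
def QuasiIdentity.Holds (φ : QuasiIdentity) (M : Type u) [Language.ring.Structure M] : Prop :=
  ∀ v : ℕ → M, (∀ e ∈ φ.premises, e.1.realize v = e.2.realize v) →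
    φ.conclusion.1.realize v = φ.conclusion.2.realize v

/-- `K` is axiomatized by `Φ`: the algebras of the signature of rings which satisfy `Φ` are
exactly the (underlying algebras of) commutative rings in `K`. -/
def IsAxiomatizedBy (K : Set CommRingCat.{u}) (Φ : Set QuasiIdentity) : Prop :=
  ∀ (M : Type u) (S : Language.ring.Structure M),
    (∀ φ ∈ Φ, φ.Holds M) ↔
      ∃ _ : CommRing M, S = (FirstOrder.Ring.compatibleRingOfRing M).toStructure ∧
        CommRingCat.of M ∈ K

/-- A quasivariety (of commutative rings) is a class axiomatized by quasi-identities. -/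
def IsQuasivariety (K : Set CommRingCat.{u}) : Prop :=
  ∃ Φ : Set QuasiIdentity, IsAxiomatizedBy K Φ

/-- A variety (of commutative rings) is a class axiomatized by identities. -/
def IsVariety (K : Set CommRingCat.{u}) : Prop :=
  ∃ Φ : Set QuasiIdentity, (∀ φ ∈ Φ, φ.IsIdentity) ∧ IsAxiomatizedBy K Φ

/-- The variables `x`, `y`, `z`. -/
def X : RingTerm := Term.var 0
def Y : RingTerm := Term.var 1
def Z : RingTerm := Term.var 2

/-- The identities defining the variety of commutative rings with `1`. -/
def commRingIdentities : Set QuasiIdentity :=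
  { .ofEq ((X + Y) + Z) (X + (Y + Z)),
    .ofEq (X + Y) (Y + X),
    .ofEq (X + 0) X,
    .ofEq (X + -X) 0,
    .ofEq ((X * Y) * Z) (X * (Y * Z)),
    .ofEq (X * Y) (Y * X),
    .ofEq (X * 1) X,
    .ofEq (X * (Y + Z)) (X * Y + X * Z) }

/-- The quasi-identity `(xyz = z) → (yz = z)`. -/
def cancelQuasiIdentity : QuasiIdentity := ⟨[(X * Y * Z, Z)], (Y * Z, Z)⟩

/-- The class of commutative rings in which each principal ideal has a unique generator. -/
def uniqueGeneratorRings : Set CommRingCat.{u} :=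
  {R | ∀ I : Ideal R, I.IsPrincipal → ∃! a : R, Ideal.span {a} = I}

/-- The class of domains in a class of commutative rings. -/
def domainsIn (K : Set CommRingCat.{u}) : Set CommRingCat.{u} := {R | IsDomain R ∧ R ∈ K}

/-- `SP(K)`: the class of rings isomorphic to a subring of a product of members of `K`
(empty products are allowed). -/
def SP (K : Set CommRingCat.{u}) : Set CommRingCat.{u} :=
  {R | ∃ (ι : Type u) (D : ι → CommRingCat.{u}), (∀ i, D i ∈ K) ∧
    ∃ f : R →+* (∀ i, D i), Function.Injective f}

/-- The `K`-ideals (relative ideals) of `R`: the ideals `I` with `R ⧸ I ∈ K`. -/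
def relIdeals (K : Set CommRingCat.{u}) (R : Type u) [CommRing R] : Set (Ideal R) :=
  {I | CommRingCat.of (R ⧸ I) ∈ K}

/-- The join of two `K`-ideals: the intersection of all `K`-ideals containing both. It is the
least `K`-ideal containing both whenever the `K`-ideals are closed under intersection. -/
def relJoin (K : Set CommRingCat.{u}) {R : Type u} [CommRing R] (I J : Ideal R) : Ideal R :=
  sInf {L | L ∈ relIdeals K R ∧ I ≤ L ∧ J ≤ L}

/-- `K` is a relatively ideal distributive quasivariety: `K` is a quasivariety and, for each
`R ∈ K`, the set of `K`-ideals of `R` is closed under arbitrary intersections (hence is a lattice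
under inclusion with meet `⊓` and join `relJoin K`), and this lattice is distributive. -/
def IsRelativelyIdealDistributive (K : Set CommRingCat.{u}) : Prop :=
  IsQuasivariety K ∧ ∀ R ∈ K,
    (∀ S : Set (Ideal R), S ⊆ relIdeals K R → sInf S ∈ relIdeals K R) ∧
    ∀ I ∈ relIdeals K R, ∀ J ∈ relIdeals K R, ∀ L ∈ relIdeals K R,
      I ⊓ relJoin K J L = relJoin K (I ⊓ J) (I ⊓ L)

/-- A ring is locally finite if each of its finitely generated subrings is finite. -/
def IsLocallyFinite (R : Type u) [CommRing R] : Prop :=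
  ∀ s : Finset R, Finite (Subring.closure (s : Set R))

/-- The class of Boolean rings. -/
def booleanRings : Set CommRingCat.{u} := {R | ∀ a : R, a ^ 2 = a}

end RingClasses

/-! In a ring, each principal ideal has a unique generator iff divisibility is antisymmetric, which
is what the quasi-identity `xyz = z → yz = z` says.

For (3) and (4) the point is that every relative ideal is an intersection of prime relative ideals.
Relative ideals are radical, and they are closed under unions of chains and under `I ↦ (I : a)`.
If `P` is maximal among the relative ideals avoiding `r` and `ab ∈ P` with `b ∉ P`, then `(P : a)`
is strictly larger than `P`, so `ra ∈ P`; if also `a ∉ P`, the same argument applied to `ra ∈ P`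
gives `r² ∈ P`, which is impossible as `P` is radical.

For (5), `aⁿ⁺¹ ∣ aⁿ` forces `aⁿ⁺¹ = aⁿ` and hence, as the ring is reduced, `a² = a`. Such an `n`
exists when `a` lies in a finite subring, and `n = 1` works when the quotient by `(a²)` is reduced.
-/

namespace RingClasses

open FirstOrder FirstOrder.Language

section Axiomatization

theorem exists_commRing_of_holds (M : Type u) [S : Language.ring.Structure M]
    (h : ∀ φ ∈ commRingIdentities, φ.Holds M) :
    ∃ _ : CommRing M, S = (FirstOrder.Ring.compatibleRingOfRing M).toStructure := by
  let := FirstOrder.Ring.addOfRingStructure M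
  let := FirstOrder.Ring.mulOfRingStructure M
  let := FirstOrder.Ring.negOfRingStructure M
  let := FirstOrder.Ring.zeroOfRingStructure M
  let := FirstOrder.Ring.oneOfRingStructure M
  let c : FirstOrder.Ring.CompatibleRing M := FirstOrder.Ring.compatibleRingOfRingStructure M
  simp only [commRingIdentities, Set.mem_insert_iff, Set.mem_singleton_iff, forall_eq_or_imp,
    forall_eq, QuasiIdentity.Holds, QuasiIdentity.ofEq, List.not_mem_nil, false_imp_iff,
    implies_true, true_imp_iff, X, Y, Z, FirstOrder.Ring.realize_add, FirstOrder.Ring.realize_mul,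
    FirstOrder.Ring.realize_neg, FirstOrder.Ring.realize_zero, FirstOrder.Ring.realize_one,
    Term.realize_var] at h
  obtain ⟨add_assoc, add_comm, add_zero, add_neg, mul_assoc, mul_comm, mul_one, mul_add⟩ := h
  let xyz (a b c : M) : ℕ → M
    | 0 => a
    | 1 => b
    | _ => c
  refine ⟨.ofMinimalAxioms (fun a b c => add_assoc (xyz a b c))
    (fun a => (add_comm (xyz 0 a 0)).trans (add_zero (xyz a a a)))
    (fun a => (add_comm (xyz (-a) a a)).trans (add_neg (xyz a a a)))
    (fun a b c => mul_assoc (xyz a b c)) (fun a b => mul_comm (xyz a b b))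
    (fun a => (mul_comm (xyz 1 a a)).trans (mul_one (xyz a a a)))
    (fun a b c => mul_add (xyz a b c)), ?_⟩
  ext n f x
  · cases f
    exacts [c.funMap_add x, c.funMap_mul x, c.funMap_neg x, c.funMap_zero x, c.funMap_one x]
  · cases f

theorem compatibleRingOfRing_toStructure_injective {M : Type*} (R R' : CommRing M)
    (h : (letI := R; FirstOrder.Ring.compatibleRingOfRing M).toStructure =
      (letI := R'; FirstOrder.Ring.compatibleRingOfRing M).toStructure) : R = R' := by
  refine CommRing.ext (funext₂ fun a b => ?_) (funext₂ fun a b => ?_)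
  · exact congrArg
      (fun S : Language.ring.Structure M => S.funMap FirstOrder.Ring.addFunc ![a, b]) h
  · exact congrArg
      (fun S : Language.ring.Structure M => S.funMap FirstOrder.Ring.mulFunc ![a, b]) h

attribute [local instance] FirstOrder.Ring.compatibleRingOfRing

/-- The class of commutative rings satisfying `Φ`. In contrast to `IsAxiomatizedBy`, the axioms of
commutative rings come from `CommRingCat` and not from `Φ`. -/
def models (Φ : Set QuasiIdentity) : Set CommRingCat.{u} := {R | ∀ φ ∈ Φ, φ.Holds R}

theorem holds_of_mem_commRingIdentities (R : Type u) [CommRing R] {φ : QuasiIdentity}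
    (hφ : φ ∈ commRingIdentities) : φ.Holds R := by
  simp only [commRingIdentities, Set.mem_insert_iff, Set.mem_singleton_iff] at hφ
  rcases hφ with rfl | rfl | rfl | rfl | rfl | rfl | rfl | rfl <;> intro v _ <;>
    simp only [QuasiIdentity.ofEq, FirstOrder.Ring.realize_add, FirstOrder.Ring.realize_mul,
      FirstOrder.Ring.realize_neg, FirstOrder.Ring.realize_zero, FirstOrder.Ring.realize_one] <;>
    ring

theorem isAxiomatizedBy_models (Φ : Set QuasiIdentity) :
    IsAxiomatizedBy.{u} (models Φ) (commRingIdentities ∪ Φ) := by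
  intro M S
  constructor
  · intro h
    obtain ⟨R, rfl⟩ := exists_commRing_of_holds M fun φ hφ => h φ (Or.inl hφ)
    exact ⟨R, rfl, fun φ hφ => h φ (Or.inr hφ)⟩
  · rintro ⟨R, rfl, hΦ⟩ φ (hφ | hφ)
    exacts [holds_of_mem_commRingIdentities M hφ, hΦ φ hφ]

theorem IsAxiomatizedBy.eq_models {K : Set CommRingCat.{u}} {Φ : Set QuasiIdentity}
    (h : IsAxiomatizedBy K Φ) : K = models Φ := by
  ext R
  refine ⟨fun hR => (h R _).2 ⟨_, rfl, hR⟩, fun hR => ?_⟩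
  obtain ⟨R', hR', hmem⟩ := (h R _).1 hR
  obtain rfl := compatibleRingOfRing_toStructure_injective _ R' hR'
  exact hmem

end Axiomatization

section Preservation

attribute [local instance] FirstOrder.Ring.compatibleRingOfRing

theorem realize_ringHom {α R S : Type*} [CommRing R] [CommRing S] (f : R →+* S) (v : α → R)
    (t : Language.ring.Term α) : t.realize (f ∘ v) = f (t.realize v) := by
  induction t with
  | var => rfl
  | func g ts ih => cases g <;> simp [Term.realize, ih]

theorem QuasiIdentity.IsIdentity.holds_of_surjective {φ : QuasiIdentity} (hφ : φ.IsIdentity)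
    {R S : Type u} [CommRing R] [CommRing S] {f : R →+* S} (hf : Function.Surjective f)
    (h : φ.Holds R) : φ.Holds S := by
  intro v _
  obtain ⟨w, rfl⟩ := hf.comp_left v
  have hw := h w fun e he => by simp [show φ.premises = [] from hφ] at he
  rw [realize_ringHom, realize_ringHom, hw]

theorem QuasiIdentity.Holds.of_injective_pi {φ : QuasiIdentity} {R : Type u} [CommRing R]
    {ι : Type*} {S : ι → Type u} [∀ i, CommRing (S i)] {f : R →+* ∀ i, S i}
    (hf : Function.Injective f) (h : ∀ i, φ.Holds (S i)) : φ.Holds R := by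
  refine fun v hv => hf (funext fun i => ?_)
  let g : R →+* S i := (Pi.evalRingHom S i).comp f
  have hg := h i (g ∘ v) fun e he => by rw [realize_ringHom, realize_ringHom, hv e he]
  rwa [realize_ringHom, realize_ringHom] at hg

theorem QuasiIdentity.Holds.quotient_sSup {φ : QuasiIdentity} {R : Type u} [CommRing R]
    {C : Set (Ideal R)} (hne : C.Nonempty) (hdir : DirectedOn (· ≤ ·) C)
    (h : ∀ I ∈ C, φ.Holds (R ⧸ I)) : φ.Holds (R ⧸ sSup C) := by
  classical
  intro v hv
  obtain ⟨w, rfl⟩ := (Ideal.Quotient.mk_surjective (I := sSup C)).comp_left v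
  simp only [realize_ringHom, Ideal.Quotient.eq] at hv ⊢
  -- The finitely many premises already hold modulo a single member of `C`.
  let d (e : RingTerm × RingTerm) : R := e.1.realize w - e.2.realize w
  have hd : ((φ.premises.toFinset.image d : Finset R) : Set R) ⊆ ⋃ I ∈ C, (I : Set R) := by
    intro a ha
    obtain ⟨e, he, rfl⟩ := Finset.mem_image.1 ha
    simpa using (Submodule.mem_sSup_of_directed hne hdir).1 (hv e (List.mem_toFinset.1 he))
  obtain ⟨I, hI, hsub⟩ := hdir.exists_mem_subset_of_finset_subset_biUnion hne hd
  refine le_sSup hI (Ideal.Quotient.eq.1 ?_)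
  simpa only [realize_ringHom] using h I hI (Ideal.Quotient.mk I ∘ w) fun e he => by
    rw [realize_ringHom, realize_ringHom, Ideal.Quotient.eq]
    exact hsub (Finset.mem_image_of_mem d (List.mem_toFinset.2 he))

variable {K : Set CommRingCat.{u}}

theorem IsVariety.quotient_mem (hK : IsVariety K) {R : CommRingCat.{u}} (hR : R ∈ K)
    (I : Ideal R) : CommRingCat.of (R ⧸ I) ∈ K := by
  obtain ⟨Φ, hΦ, hax⟩ := hK
  obtain rfl := hax.eq_models
  exact fun φ hφ => (hΦ φ hφ).holds_of_surjective Ideal.Quotient.mk_surjective (hR φ hφ)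

theorem SP_mono {K' : Set CommRingCat.{u}} (h : K ⊆ K') : SP K ⊆ SP K' :=
  fun _ ⟨ι, D, hD, hf⟩ => ⟨ι, D, fun i => h (hD i), hf⟩

theorem IsQuasivariety.SP_subset (hK : IsQuasivariety K) : SP K ⊆ K := by
  obtain ⟨Φ, hax⟩ := hK
  obtain rfl := hax.eq_models
  exact fun R ⟨_, D, hD, f, hf⟩ φ hφ => .of_injective_pi (S := fun i => D i) hf fun i => hD i φ hφ

variable {R : Type u} [CommRing R]

theorem IsQuasivariety.bot_mem_relIdeals (hK : IsQuasivariety K) (hR : CommRingCat.of R ∈ K) :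
    ⊥ ∈ relIdeals K R :=
  hK.SP_subset ⟨PUnit, fun _ => .of R, fun _ => hR,
    RingHom.pi fun _ => (RingEquiv.quotientBot R).toRingHom,
    fun _ _ h => (RingEquiv.quotientBot R).injective (congrFun h PUnit.unit)⟩

theorem IsQuasivariety.sInf_mem_relIdeals (hK : IsQuasivariety K) {S : Set (Ideal R)}
    (hS : S ⊆ relIdeals K R) : sInf S ∈ relIdeals K R := by
  rw [sInf_eq_iInf']
  exact hK.SP_subset ⟨S, fun I => .of (R ⧸ I.1), fun I => hS I.2,
    Ideal.quotientInfToPiQuotient _, Ideal.quotientInfToPiQuotient_inj _⟩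

theorem IsQuasivariety.sSup_mem_relIdeals (hK : IsQuasivariety K) {C : Set (Ideal R)}
    (hC : C ⊆ relIdeals K R) (hne : C.Nonempty) (hdir : DirectedOn (· ≤ ·) C) :
    sSup C ∈ relIdeals K R := by
  obtain ⟨Φ, hax⟩ := hK
  obtain rfl := hax.eq_models
  exact fun φ hφ => .quotient_sSup hne hdir fun I hI => hC hI φ hφ

end Preservation

section PrimeRelativeIdeals

variable {K : Set CommRingCat.{u}} {R : Type u} [CommRing R]

/-- Every `K`-ideal of `R` is an intersection of prime `K`-ideals, in the form of a separation
property. -/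
def HasEnoughPrimes (K : Set CommRingCat.{u}) (R : Type u) [CommRing R] : Prop :=
  ∀ I ∈ relIdeals K R, ∀ r ∉ I, ∃ P ∈ relIdeals K R, P.IsPrime ∧ I ≤ P ∧ r ∉ P

theorem isPrime_of_maximal_notMem {R : Type*} [CommRing R] {𝓛 : Set (Ideal R)}
    (hcolon : ∀ I ∈ 𝓛, ∀ a, I.colon {a} ∈ 𝓛) {P : Ideal R} (hrad : P.IsRadical) {r : R}
    (hP : Maximal (fun I => I ∈ 𝓛 ∧ r ∉ I) P) : P.IsPrime := by
  obtain ⟨hP𝓛, hrP⟩ := hP.prop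
  have mul_mem_of_mul_mem {a b : R} (hab : a * b ∈ P) (hb : b ∉ P) : r * a ∈ P := by
    by_contra hra
    have hle : P ≤ P.colon {a} := fun c hc => Submodule.mem_colon_singleton.2 (P.mul_mem_right a hc)
    have hr : r ∉ P.colon {a} := fun h => hra (Submodule.mem_colon_singleton.1 h)
    have hb' : b ∈ P.colon {a} := Submodule.mem_colon_singleton.2 (by rwa [smul_eq_mul, mul_comm])
    exact hb (hP.le_of_ge ⟨hcolon P hP𝓛 a, hr⟩ hle hb')
  refine ⟨fun h => hrP (h ▸ Submodule.mem_top), fun {a b} hab => ?_⟩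
  by_contra! h
  have hrr : r * r ∈ P := mul_mem_of_mul_mem (mul_mem_of_mul_mem hab h.2) h.1
  exact hrP (hrad ⟨2, by rwa [sq]⟩)

theorem IsQuasivariety.hasEnoughPrimes (hK : IsQuasivariety K)
    (hrad : ∀ I ∈ relIdeals K R, I.IsRadical)
    (hcolon : ∀ I ∈ relIdeals K R, ∀ a, I.colon {a} ∈ relIdeals K R) : HasEnoughPrimes K R := by
  intro I hI r hr
  obtain ⟨P, hIP, hP⟩ := zorn_le_nonempty₀ {J | J ∈ relIdeals K R ∧ r ∉ J}
    (fun C hC hchain J hJ => by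
      have hdir := hchain.directedOn
      refine ⟨sSup C, ⟨hK.sSup_mem_relIdeals (fun L hL => (hC hL).1) ⟨J, hJ⟩ hdir, fun h => ?_⟩,
        fun L hL => le_sSup hL⟩
      obtain ⟨L, hL, hrL⟩ := (Submodule.mem_sSup_of_directed ⟨J, hJ⟩ hdir).1 h
      exact (hC hL).2 hrL) I ⟨hI, hr⟩
  exact ⟨P, hP.prop.1, isPrime_of_maximal_notMem hcolon (hrad P hP.prop.1) hP, hIP, hP.prop.2⟩

theorem HasEnoughPrimes.inf_relJoin (h : HasEnoughPrimes K R) {I : Ideal R}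
    (hI : I ∈ relIdeals K R) (J L : Ideal R) :
    I ⊓ relJoin K J L = relJoin K (I ⊓ J) (I ⊓ L) := by
  apply le_antisymm
  · refine le_sInf fun M ⟨hM, hIJ, hIL⟩ x ⟨hxI, hx⟩ => ?_
    by_contra hxM
    obtain ⟨P, hP, hprime, hMP, hxP⟩ := h M hM x hxM
    have hIP : ¬ I ≤ P := fun h => hxP (h hxI)
    have hJP : J ≤ P := (hprime.inf_le.1 (hIJ.trans hMP)).resolve_left hIP
    have hLP : L ≤ P := (hprime.inf_le.1 (hIL.trans hMP)).resolve_left hIP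
    exact hxP (Submodule.mem_sInf.1 hx P ⟨hP, hJP, hLP⟩)
  · refine le_inf (sInf_le ⟨hI, inf_le_left, inf_le_left⟩) (le_sInf fun M ⟨hM, hJM, hLM⟩ => ?_)
    exact sInf_le ⟨hM, inf_le_right.trans hJM, inf_le_right.trans hLM⟩

theorem HasEnoughPrimes.mem_SP_domainsIn (h : HasEnoughPrimes K R) (hbot : ⊥ ∈ relIdeals K R) :
    CommRingCat.of R ∈ SP (domainsIn K) := by
  choose P hP hprime _ hrP using fun r : {r : R // r ∉ (⊥ : Ideal R)} => h ⊥ hbot r r.2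
  refine ⟨_, fun r => .of (R ⧸ P r),
    fun r => ⟨(Ideal.Quotient.isDomain_iff_prime _).2 (hprime r), hP r⟩,
    RingHom.pi fun r => Ideal.Quotient.mk (P r), (injective_iff_map_eq_zero _).2 fun a ha => ?_⟩
  by_contra hne
  exact hrP ⟨a, hne⟩ (Ideal.Quotient.eq_zero_iff_mem.1 (congrFun ha ⟨a, hne⟩))

theorem IsQuasivariety.eq_SP_domainsIn (hK : IsQuasivariety K)
    (h : ∀ R ∈ K, HasEnoughPrimes K R) : K = SP (domainsIn K) :=
  Set.Subset.antisymm (fun R hR => (h R hR).mem_SP_domainsIn (hK.bot_mem_relIdeals hR))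
    ((SP_mono fun _ hR => hR.2).trans hK.SP_subset)

theorem IsQuasivariety.isRelativelyIdealDistributive (hK : IsQuasivariety K)
    (h : ∀ R ∈ K, HasEnoughPrimes K R) : IsRelativelyIdealDistributive K :=
  ⟨hK, fun R hR => ⟨fun _ => hK.sInf_mem_relIdeals,
    fun _ hI J _ L _ => (h R hR).inf_relJoin hI J L⟩⟩

end PrimeRelativeIdeals

section DvdAntisymm

/-- Divisibility is antisymmetric. For a commutative ring this is the elementwise form of
membership in `uniqueGeneratorRings`, see `mem_uniqueGeneratorRings_iff_dvdAntisymm`. -/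
def DvdAntisymm (M : Type*) [Semigroup M] : Prop := ∀ ⦃a b : M⦄, a ∣ b → b ∣ a → a = b

theorem dvdAntisymm_iff_cancel {M : Type*} [CommSemigroup M] :
    DvdAntisymm M ↔ ∀ x y z : M, x * y * z = z → y * z = z := by
  constructor
  · intro h x y z hxyz
    exact h ⟨x, by rw [mul_comm, ← mul_assoc, hxyz]⟩ (Dvd.intro_left y rfl)
  · rintro h a _ ⟨y, rfl⟩ ⟨x, hx⟩
    have hya : y * a = a := h x y a (by rw [mul_comm, mul_comm x, ← mul_assoc, ← hx])
    rw [mul_comm, hya]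

theorem DvdAntisymm.subsingleton_units {M : Type*} [CommMonoid M] (h : DvdAntisymm M) :
    Subsingleton Mˣ :=
  ⟨fun a b => Units.ext (h a.isUnit.dvd b.isUnit.dvd)⟩

theorem dvdAntisymm_iff_subsingleton_units {M : Type*} [CommMonoidWithZero M]
    [IsCancelMulZero M] : DvdAntisymm M ↔ Subsingleton Mˣ :=
  ⟨DvdAntisymm.subsingleton_units, fun _ _ _ => dvd_antisymm⟩

theorem dvdAntisymm_of_isIdempotentElem {M : Type*} [CommSemigroup M]
    (h : ∀ a : M, IsIdempotentElem a) : DvdAntisymm M := by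
  rintro a _ ⟨c, rfl⟩ ⟨d, hd⟩
  calc a = a * c * d := hd
    _ = a * (c * c) * d := by rw [(h c).eq]
    _ = a * c * d * c := by ac_rfl
    _ = a * c := by rw [← hd]

theorem isReduced_of_subsingleton_units {R : Type*} [Ring R] [Subsingleton Rˣ] : IsReduced R where
  eq_zero x hx := by
    simpa using congrArg Units.val (Subsingleton.elim hx.isUnit_add_one.unit 1)

theorem nonempty_algebra_zmod_two_of_subsingleton_units {R : Type*} [Ring R] [Subsingleton Rˣ] :
    Nonempty (Algebra (ZMod 2) R) := by
  have hneg : (-1 : R) = 1 := congrArg Units.val (Subsingleton.elim (-1 : Rˣ) 1)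
  have htwo : ((2 : ℕ) : R) = 0 := by
    rw [Nat.cast_two, ← one_add_one_eq_two, add_eq_zero_iff_eq_neg, hneg]
  exact ⟨ZMod.algebra' R (ringChar R) (ringChar.dvd htwo)⟩

theorem DvdAntisymm.isReduced {R : Type*} [CommRing R] (h : DvdAntisymm R) : IsReduced R :=
  have := h.subsingleton_units
  isReduced_of_subsingleton_units

theorem DvdAntisymm.isIdempotentElem_of_pow_succ_dvd {R : Type*} [CommRing R]
    (h : DvdAntisymm R) {a : R} {n : ℕ} (ha : a ^ (n + 1) ∣ a ^ n) : IsIdempotentElem a := by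
  have := h.isReduced
  have hpow : a ^ (n + 1) = a ^ n := h ha (pow_dvd_pow a n.le_succ)
  have hnil : (a * a - a) ^ (n + 1) = 0 :=
    calc (a * a - a) ^ (n + 1) = (a ^ (n + 1) * (a - 1)) * (a - 1) ^ n := by
          rw [← mul_sub_one, mul_pow, pow_succ' (a - 1), mul_assoc]
      _ = 0 := by rw [mul_sub_one, ← pow_succ, pow_succ a (n + 1), hpow, ← pow_succ, hpow,
          sub_self, zero_mul]
  exact sub_eq_zero.1 (eq_zero_of_pow_eq_zero hnil)

end DvdAntisymm

section UniqueGenerators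

theorem mem_uniqueGeneratorRings_iff_dvdAntisymm {R : CommRingCat.{u}} :
    R ∈ uniqueGeneratorRings ↔ DvdAntisymm R := by
  constructor
  · intro h a b hab hba
    exact (h (Ideal.span {a}) inferInstance).unique rfl (le_antisymm
      (Ideal.span_singleton_le_span_singleton.2 hab)
      (Ideal.span_singleton_le_span_singleton.2 hba))
  · rintro h I ⟨a, rfl⟩
    exact ⟨a, rfl, fun b (hb : Ideal.span {b} = Ideal.span {a}) =>
      h (Ideal.span_singleton_le_span_singleton.1 hb.ge)
        (Ideal.span_singleton_le_span_singleton.1 hb.le)⟩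

theorem mem_uniqueGeneratorRings_iff_cancel {R : CommRingCat.{u}} :
    R ∈ uniqueGeneratorRings ↔ ∀ x y z : R, x * y * z = z → y * z = z :=
  mem_uniqueGeneratorRings_iff_dvdAntisymm.trans dvdAntisymm_iff_cancel

theorem uniqueGeneratorRings_eq_models :
    uniqueGeneratorRings.{u} = models {cancelQuasiIdentity} := by
  ext R
  let := FirstOrder.Ring.compatibleRingOfRing R
  rw [mem_uniqueGeneratorRings_iff_cancel]
  simp only [models, Set.mem_ofPred_eq, Set.mem_singleton_iff, forall_eq, QuasiIdentity.Holds,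
    cancelQuasiIdentity, List.mem_singleton, X, Y, Z, FirstOrder.Ring.realize_mul,
    Term.realize_var]
  exact ⟨fun h v => h _ _ _, fun h x y z => h fun | 0 => x | 1 => y | _ => z⟩

theorem isAxiomatizedBy_uniqueGeneratorRings :
    IsAxiomatizedBy uniqueGeneratorRings.{u} (commRingIdentities ∪ {cancelQuasiIdentity}) :=
  uniqueGeneratorRings_eq_models ▸ isAxiomatizedBy_models _

theorem isQuasivariety_uniqueGeneratorRings : IsQuasivariety uniqueGeneratorRings.{u} :=
  ⟨_, isAxiomatizedBy_uniqueGeneratorRings⟩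

theorem domainsIn_uniqueGeneratorRings :
    domainsIn uniqueGeneratorRings.{u} = {R : CommRingCat.{u} | IsDomain R ∧ ∀ a : Rˣ, a = 1} := by
  ext R
  refine and_congr_right fun _ => ?_
  rw [mem_uniqueGeneratorRings_iff_dvdAntisymm, dvdAntisymm_iff_subsingleton_units]
  exact ⟨fun _ a => Subsingleton.elim a 1, subsingleton_of_forall_eq 1⟩

variable {R : Type u} [CommRing R] {I : Ideal R}

theorem mem_relIdeals_uniqueGeneratorRings_iff :
    I ∈ relIdeals uniqueGeneratorRings R ↔ ∀ x y z : R, x * y * z - z ∈ I → y * z - z ∈ I := by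
  rw [relIdeals, Set.mem_ofPred_eq, mem_uniqueGeneratorRings_iff_cancel]
  simp only [CommRingCat.coe_of, Ideal.Quotient.mk_surjective.forall, ← map_mul,
    Ideal.Quotient.eq]

theorem isRadical_of_mem_relIdeals_uniqueGeneratorRings
    (hI : I ∈ relIdeals uniqueGeneratorRings R) : I.IsRadical :=
  (Ideal.isRadical_iff_quotient_reduced I).2
    (mem_uniqueGeneratorRings_iff_dvdAntisymm.1 hI).isReduced

theorem colon_singleton_mem_relIdeals_uniqueGeneratorRings
    (hI : I ∈ relIdeals uniqueGeneratorRings R) (a : R) :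
    I.colon {a} ∈ relIdeals uniqueGeneratorRings R := by
  simp only [mem_relIdeals_uniqueGeneratorRings_iff, Submodule.mem_colon_singleton, smul_eq_mul,
    sub_mul, mul_assoc] at hI ⊢
  exact fun x y z => hI x y (z * a)

theorem hasEnoughPrimes_uniqueGeneratorRings (R : Type u) [CommRing R] :
    HasEnoughPrimes uniqueGeneratorRings R :=
  isQuasivariety_uniqueGeneratorRings.hasEnoughPrimes
    (fun _ => isRadical_of_mem_relIdeals_uniqueGeneratorRings)
    fun _ => colon_singleton_mem_relIdeals_uniqueGeneratorRings

end UniqueGenerators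

section Boolean

theorem mem_booleanRings_iff {R : CommRingCat.{u}} :
    R ∈ booleanRings ↔ ∀ a : R, IsIdempotentElem a := by
  simp only [booleanRings, Set.mem_ofPred_eq, sq, IsIdempotentElem]

theorem booleanRings_subset_uniqueGeneratorRings : booleanRings.{u} ⊆ uniqueGeneratorRings :=
  fun _ hR => mem_uniqueGeneratorRings_iff_dvdAntisymm.2
    (dvdAntisymm_of_isIdempotentElem (mem_booleanRings_iff.1 hR))

theorem isVariety_booleanRings : IsVariety booleanRings.{u} := by
  refine ⟨commRingIdentities ∪ {.ofEq (X * X) X}, ?_, ?_⟩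
  · simp only [commRingIdentities, Set.mem_union, Set.mem_insert_iff, Set.mem_singleton_iff]
    rintro φ ((rfl | rfl | rfl | rfl | rfl | rfl | rfl | rfl) | rfl) <;> rfl
  · convert isAxiomatizedBy_models.{u} {.ofEq (X * X) X} using 1
    ext R
    let := FirstOrder.Ring.compatibleRingOfRing R
    simp only [mem_booleanRings_iff, IsIdempotentElem, models, Set.mem_ofPred_eq,
      Set.mem_singleton_iff, forall_eq, QuasiIdentity.Holds, QuasiIdentity.ofEq, X,
      FirstOrder.Ring.realize_mul, Term.realize_var]
    exact ⟨fun h v _ => h _, fun h a => h (fun _ => a) (by simp)⟩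

theorem isLocallyFinite_of_isIntegral (k : Type*) {R : Type u} [CommRing k] [Finite k] [CommRing R]
    [Algebra k R] [Algebra.IsIntegral k R] : IsLocallyFinite R := by
  intro s
  have := Algebra.finite_adjoin_of_finite_of_isIntegral (R := k) s.finite_toSet
    fun x _ => Algebra.IsIntegral.isIntegral x
  have hfin : Finite (Algebra.adjoin k (s : Set R)) := Module.finite_of_finite k
  have hle : Subring.closure (s : Set R) ≤ (Algebra.adjoin k (s : Set R)).toSubring :=
    Subring.closure_le.2 Algebra.subset_adjoin
  exact Set.Finite.subset (s := (Algebra.adjoin k (s : Set R) : Set R)) hfin hle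

theorem isLocallyFinite_of_mem_booleanRings {R : CommRingCat.{u}} (hR : R ∈ booleanRings) :
    IsLocallyFinite R := by
  have := (mem_uniqueGeneratorRings_iff_dvdAntisymm.1
    (booleanRings_subset_uniqueGeneratorRings hR)).subsingleton_units
  obtain ⟨_⟩ := nonempty_algebra_zmod_two_of_subsingleton_units (R := R)
  have : Algebra.IsIntegral (ZMod 2) R :=
    ⟨fun a => ⟨Polynomial.X ^ 2 - Polynomial.X, Polynomial.monic_X_pow_sub (by simp),
      by simp [hR a]⟩⟩
  exact isLocallyFinite_of_isIntegral (ZMod 2)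

theorem IsLocallyFinite.exists_pow_succ_dvd_pow {R : Type u} [CommRing R] (h : IsLocallyFinite R)
    (a : R) : ∃ n : ℕ, a ^ (n + 1) ∣ a ^ n := by
  let A := Subring.closure (({a} : Finset R) : Set R)
  have : Finite A := h {a}
  let b : A := ⟨a, Subring.subset_closure (by simp)⟩
  obtain ⟨n, c, hc⟩ := IsArtinian.exists_pow_succ_smul_dvd b (1 : A)
  exact ⟨n, c, by simpa using congrArg Subtype.val hc.symm⟩

theorem mem_booleanRings_iff_isLocallyFinite {R : CommRingCat.{u}} :
    R ∈ booleanRings ↔ R ∈ uniqueGeneratorRings ∧ IsLocallyFinite R := by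
  refine ⟨fun hR => ⟨booleanRings_subset_uniqueGeneratorRings hR,
    isLocallyFinite_of_mem_booleanRings hR⟩, fun ⟨hR, hfin⟩ => mem_booleanRings_iff.2 fun a => ?_⟩
  obtain ⟨n, hn⟩ := hfin.exists_pow_succ_dvd_pow a
  exact (mem_uniqueGeneratorRings_iff_dvdAntisymm.1 hR).isIdempotentElem_of_pow_succ_dvd hn

theorem IsVariety.subset_booleanRings {V : Set CommRingCat.{u}} (hV : IsVariety V)
    (hsub : V ⊆ uniqueGeneratorRings) : V ⊆ booleanRings := by
  refine fun R hR => mem_booleanRings_iff.2 fun a => ?_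
  have hrad : (Ideal.span {a ^ 2}).IsRadical :=
    isRadical_of_mem_relIdeals_uniqueGeneratorRings (hsub (hV.quotient_mem hR _))
  have hdvd : a ^ 2 ∣ a := Ideal.mem_span_singleton.1 (hrad ⟨2, Ideal.mem_span_singleton_self _⟩)
  exact (mem_uniqueGeneratorRings_iff_dvdAntisymm.1 (hsub hR)).isIdempotentElem_of_pow_succ_dvd
    (n := 1) (by simpa using hdvd)

end Boolean

end RingClasses

theorem theorem2p1 :
    -- (1)
    (RingClasses.IsQuasivariety RingClasses.uniqueGeneratorRings.{u} ∧
      RingClasses.IsAxiomatizedBy RingClasses.uniqueGeneratorRings.{u}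
        (RingClasses.commRingIdentities ∪ {RingClasses.cancelQuasiIdentity}) ∧
      (∀ R : CommRingCat.{u}, R ∈ RingClasses.uniqueGeneratorRings ↔
        ∀ x y z : R, x * y * z = z → y * z = z) ∧
      (∀ R ∈ RingClasses.uniqueGeneratorRings.{u},
        (∀ a : Rˣ, a = 1) ∧ IsReduced R ∧ Nonempty (Algebra (ZMod 2) R))) ∧
    -- (2)
    (RingClasses.domainsIn RingClasses.uniqueGeneratorRings.{u} =
      {R : CommRingCat.{u} | IsDomain R ∧ ∀ a : Rˣ, a = 1}) ∧
    -- (3)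
    (RingClasses.uniqueGeneratorRings.{u} =
      RingClasses.SP (RingClasses.domainsIn RingClasses.uniqueGeneratorRings.{u})) ∧
    -- (4)
    RingClasses.IsRelativelyIdealDistributive RingClasses.uniqueGeneratorRings.{u} ∧
    -- (5)
    ({R : CommRingCat.{u} | R ∈ RingClasses.uniqueGeneratorRings ∧
        RingClasses.IsLocallyFinite R} = RingClasses.booleanRings ∧
      IsGreatest {V : Set CommRingCat.{u} | RingClasses.IsVariety V ∧
        V ⊆ RingClasses.uniqueGeneratorRings} RingClasses.booleanRings) := by
  open RingClasses in
  have hQ := isQuasivariety_uniqueGeneratorRings.{u}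
  have primes (R : CommRingCat.{u}) (_ : R ∈ uniqueGeneratorRings) :=
    hasEnoughPrimes_uniqueGeneratorRings R
  refine ⟨⟨hQ, isAxiomatizedBy_uniqueGeneratorRings,
      fun R => mem_uniqueGeneratorRings_iff_cancel, fun R hR => ?_⟩,
    domainsIn_uniqueGeneratorRings, hQ.eq_SP_domainsIn primes,
    hQ.isRelativelyIdealDistributive primes,
    Set.ext fun R => mem_booleanRings_iff_isLocallyFinite.symm,
    ⟨isVariety_booleanRings, booleanRings_subset_uniqueGeneratorRings⟩,
    fun V hV => hV.1.subset_booleanRings hV.2⟩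
  have hdvd : DvdAntisymm R := mem_uniqueGeneratorRings_iff_dvdAntisymm.1 hR
  have := hdvd.subsingleton_units
  exact ⟨fun a => Subsingleton.elim a 1, hdvd.isReduced,
    nonempty_algebra_zmod_two_of_subsingleton_units⟩
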